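/- Let $\mathbb{R}^{1+d}$ ($d\ge 0$ an integer) be Minkowski space with the metric $m=-dt^2+dx_1^2+\dots+dx_d^2$, let $\mathbb{R}$ carry the metric $ds^2$, and let $(N,h)$ be a smooth finite-dimensional Riemannian manifold without boundary. Geodesics are smooth curves $\gamma$ with $\nabla_{\dot\gamma}\dot\gamma=0$ for the Levi-Civita connection (constant curves are allowed). A smooth map $f$ between pseudo-Riemannian manifolds is called totally geodesic if for every geodesic $\gamma:(a,b)\to M$ of the source, $f\circ\gamma:(a,b)\to N$ is a geodesic of the target. A submersion (immersion) is a smooth map whose differential is surjective (injective) at every point. Let $\varphi:(\mathbb{R}^{1+d},m)\to(N,h)$ be a totally geodesic map whose differential $\varphi_*$ has rank $1$ at every point. Then: 1. There are a totally geodesic submersion $\varphi_S:(\mathbb{R}^{1+d},m)\to\mathbb{R}$ and a totally geodesic immersion $\varphi_I:\mathbb{R}\to(N,h)$ such that $\varphi=\varphi_I\circ\varphi_S$. 2. For every such factorization, $\varphi_S$ is an affine function, $\varphi_I$ is a geodesic of $(N,h)$ defined on all of $\mathbb{R}$, and the function $$m(d\varphi_S,d\varphi_S)=-(\partial_t\varphi_S)^2+\sum_{i=1}^d(\partial_{x_i}\varphi_S)^2$$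 is constant on $\mathbb{R}^{1+d}$. 3. Call $\varphi$ time-like, null or space-like if it has a factorization as in 1 with $m(d\varphi_S,d\varphi_S)<0$, $=0$ or $>0$ everywhere, respectively. Then $\varphi$ is exactly one of time-like, null and space-like. -/

import Mathlib

open Set
open scoped Manifold ContDiff

noncomputable section

/-- A smooth pseudo-Riemannian metric on a manifold `M` (without boundary) modelled on `E`. -/
structure PseudoRiemannianMetric (E : Type*) [NormedAddCommGroup E] [NormedSpace ℝ E]
    (M : Type*) [TopologicalSpace M] [ChartedSpace E M] [IsManifold 𝓘(ℝ, E) ∞ M] where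
  /-- The scalar product on each tangent space. -/
  form (x : M) : TangentSpace 𝓘(ℝ, E) x →L[ℝ] TangentSpace 𝓘(ℝ, E) x →L[ℝ] ℝ
  symm (x : M) (v w : TangentSpace 𝓘(ℝ, E) x) : form x v w = form x w v
  nondegenerate (x : M) (v : TangentSpace 𝓘(ℝ, E) x) (hv : ∀ w, form x v w = 0) : v = 0
  contMDiff : ContMDiff 𝓘(ℝ, E) (𝓘(ℝ, E).prod 𝓘(ℝ, E →L[ℝ] E →L[ℝ] ℝ)) ∞
    (fun x ↦ Bundle.TotalSpace.mk' (E →L[ℝ] E →L[ℝ] ℝ)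
      (E := fun x : M ↦ TangentSpace 𝓘(ℝ, E) x →L[ℝ] TangentSpace 𝓘(ℝ, E) x →L[ℝ] ℝ)
      x (form x))

/-- A smooth Riemannian metric, seen as a pseudo-Riemannian metric. -/
def Bundle.ContMDiffRiemannianMetric.toPseudo {E : Type*} [NormedAddCommGroup E] [NormedSpace ℝ E]
    {M : Type*} [TopologicalSpace M] [ChartedSpace E M] [IsManifold 𝓘(ℝ, E) ∞ M]
    (h : Bundle.ContMDiffRiemannianMetric 𝓘(ℝ, E) ∞ E
      (fun x : M ↦ TangentSpace 𝓘(ℝ, E) x)) :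
    PseudoRiemannianMetric E M where
  form := h.inner
  symm := h.symm
  nondegenerate x v hv := by
    by_contra hne
    exact (h.pos x v hne).ne' (hv v)
  contMDiff := h.contMDiff

namespace PseudoRiemannianMetric

section Constant

variable {E : Type*} [NormedAddCommGroup E] [NormedSpace ℝ E]

/-- A bilinear form on a vector space, seen as a bilinear form on each tangent space. -/
def constForm (B : E →L[ℝ] E →L[ℝ] ℝ) (x : E) :
    TangentSpace 𝓘(ℝ, E) x →L[ℝ] TangentSpace 𝓘(ℝ, E) x →L[ℝ] ℝ :=
  B

/-- The constant metric on a vector space given by a nondegenerate symmetric bilinear form. -/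
def const (B : E →L[ℝ] E →L[ℝ] ℝ) (hsymm : ∀ v w, B v w = B w v)
    (hB : ∀ v, (∀ w, B v w = 0) → v = 0) : PseudoRiemannianMetric E E where
  form := constForm B
  symm _ v w := hsymm v w
  nondegenerate _ v hv := hB v hv
  contMDiff := by
    intro x
    rw [Bundle.contMDiffAt_section]
    refine (contMDiffAt_const (c := B)).congr_of_eventuallyEq (Filter.Eventually.of_forall ?_)
    intro y
    ext v w
    simp [hom_trivializationAt_apply, ContinuousLinearMap.inCoordinates]
    rw [Bundle.Trivialization.linearMapAt_apply, if_pos (by simp; exact mem_univ y)]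
    simp [hom_trivializationAt_apply, ContinuousLinearMap.inCoordinates]
    rfl

end Constant

variable {E : Type*} [NormedAddCommGroup E] [NormedSpace ℝ E]
  {M : Type*} [TopologicalSpace M] [ChartedSpace E M] [IsManifold 𝓘(ℝ, E) ∞ M]
  (g : PseudoRiemannianMetric E M)

/-- The coordinate expression `(g_{ij}(y))` of the metric in the chart `e`, at `y ∈ e.target`:
the pull-back of the metric under `e.symm`. -/
def inChart (e : OpenPartialHomeomorph M E) (y : E) : E →L[ℝ] E →L[ℝ] ℝ :=
  let D : E →L[ℝ] TangentSpace 𝓘(ℝ, E) (e.symm y) := mfderiv 𝓘(ℝ, E) 𝓘(ℝ, E) e.symm y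
  (ContinuousLinearMap.precomp ℝ D) ∘L (g.form (e.symm y)) ∘L D

/-- The Christoffel symbols `Γ(y)(u, v) = Γ^k_{ij}(y) u^i v^j ∂_k` of the Levi-Civita connection in
the chart `e`: the vector such that, for all `w`,
`2 g(Γ(u, v), w) = ∂_u g(v, w) + ∂_v g(u, w) - ∂_w g(u, v)`. -/
def christoffel (e : OpenPartialHomeomorph M E) (y u v : E) : E :=
  let dG : E →L[ℝ] E →L[ℝ] E →L[ℝ] ℝ := fderiv ℝ (g.inChart e) y
  (g.inChart e y).inverse ((1 / 2 : ℝ) • (dG u v + dG v u - (dG.flip u).flip v))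

/-- `γ` is a (smooth, affinely parametrized, possibly constant) geodesic on the open set `s` of
parameters: in every chart, `(γ^k)'' + Γ^k_{ij}(γ) (γ^i)' (γ^j)' = 0`. -/
structure IsGeodesicOn (γ : ℝ → M) (s : Set ℝ) : Prop where
  contMDiffOn : ContMDiffOn 𝓘(ℝ, ℝ) 𝓘(ℝ, E) ∞ γ s
  geodesic_eq : ∀ t ∈ s, ∀ e ∈ atlas E M, γ t ∈ e.source →
    deriv (deriv (e ∘ γ)) t
      + g.christoffel e (e (γ t)) (deriv (e ∘ γ) t) (deriv (e ∘ γ) t) = 0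

/-- The scalar product on covectors induced by the metric: `g(α, β) = g^{ij} α_i β_j`. -/
def dual (x : M) (α β : TangentSpace 𝓘(ℝ, E) x →L[ℝ] ℝ) : ℝ :=
  α ((g.form x).inverse β)

end PseudoRiemannianMetric

section Maps

variable {E : Type*} [NormedAddCommGroup E] [NormedSpace ℝ E]
  {M : Type*} [TopologicalSpace M] [ChartedSpace E M] [IsManifold 𝓘(ℝ, E) ∞ M]
  {E' : Type*} [NormedAddCommGroup E'] [NormedSpace ℝ E']
  {N : Type*} [TopologicalSpace N] [ChartedSpace E' N] [IsManifold 𝓘(ℝ, E') ∞ N]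

/-- A smooth map is totally geodesic if it maps geodesics to geodesics. -/
structure IsTotallyGeodesic (g : PseudoRiemannianMetric E M) (h : PseudoRiemannianMetric E' N)
    (f : M → N) : Prop where
  contMDiff : ContMDiff 𝓘(ℝ, E) 𝓘(ℝ, E') ∞ f
  map_geodesic : ∀ (γ : ℝ → M) (a b : ℝ),
    g.IsGeodesicOn γ (Ioo a b) → h.IsGeodesicOn (f ∘ γ) (Ioo a b)

end Maps

/-- The underlying manifold of the Minkowski space `ℝ^{1+d}`; the coordinate `0` is the time. -/
abbrev MinkowskiSpace (d : ℕ) : Type := EuclideanSpace ℝ (Fin (d + 1))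

/-- The Minkowski scalar product `- v_0 w_0 + v_1 w_1 + ⋯ + v_d w_d`. -/
def minkowskiForm (d : ℕ) : MinkowskiSpace d →L[ℝ] MinkowskiSpace d →L[ℝ] ℝ :=
  -(EuclideanSpace.proj (𝕜 := ℝ) (0 : Fin (d + 1))).smulRight
      (EuclideanSpace.proj (𝕜 := ℝ) (0 : Fin (d + 1)))
    + ∑ i : Fin d, (EuclideanSpace.proj (𝕜 := ℝ) i.succ).smulRight
        (EuclideanSpace.proj (𝕜 := ℝ) i.succ)

lemma minkowskiForm_apply (d : ℕ) (v w : MinkowskiSpace d) :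
    minkowskiForm d v w = -(v 0 * w 0) + ∑ i : Fin d, v i.succ * w i.succ := by
  simp [minkowskiForm]

/-- The Minkowski metric `m = -dt² + dx_1² + ⋯ + dx_d²`. -/
def minkowskiMetric (d : ℕ) : PseudoRiemannianMetric (MinkowskiSpace d) (MinkowskiSpace d) :=
  .const (minkowskiForm d)
    (fun v w ↦ by simp only [minkowskiForm_apply, mul_comm])
    (fun v hv ↦ by
      ext i
      have h := hv (EuclideanSpace.single i 1)
      rw [minkowskiForm_apply] at h
      refine Fin.cases (fun h ↦ ?_) (fun j h ↦ ?_) i h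
      · simpa [Fin.succ_ne_zero] using h
      · simpa [(Fin.succ_ne_zero _).symm] using h)

/-- The standard scalar product of the real line. -/
def realForm : ℝ →L[ℝ] ℝ →L[ℝ] ℝ := ContinuousLinearMap.mul ℝ ℝ

lemma realForm_apply (v w : ℝ) : realForm v w = v * w := rfl

lemma realForm_symm (v w : ℝ) : realForm v w = realForm w v := mul_comm v w

lemma realForm_nondegenerate (v : ℝ) (hv : ∀ w, realForm v w = 0) : v = 0 := by
  simpa [realForm_apply] using hv 1

/-- The standard metric `ds²` of the real line. -/
def realMetric : PseudoRiemannianMetric ℝ ℝ :=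
  .const realForm realForm_symm realForm_nondegenerate

section Factorization

variable {E : Type*} [NormedAddCommGroup E] [NormedSpace ℝ E]
  {N : Type*} [TopologicalSpace N] [ChartedSpace E N] [IsManifold 𝓘(ℝ, E) ∞ N]
  {d : ℕ}

/-- `φ = φI ∘ φS`, where `φS : ℝ^{1+d} → ℝ` is a totally geodesic submersion and `φI : ℝ → N` is a
totally geodesic immersion. -/
structure IsTotallyGeodesicFactorization (h : PseudoRiemannianMetric E N)
    (φ : MinkowskiSpace d → N) (φS : MinkowskiSpace d → ℝ) (φI : ℝ → N) : Prop where
  eq_comp : φ = φI ∘ φS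
  totallyGeodesic_fst : IsTotallyGeodesic (minkowskiMetric d) realMetric φS
  submersion : ∀ x, Function.Surjective (mfderiv 𝓘(ℝ, MinkowskiSpace d) 𝓘(ℝ, ℝ) φS x)
  totallyGeodesic_snd : IsTotallyGeodesic realMetric h φI
  immersion : ∀ s, Function.Injective (mfderiv 𝓘(ℝ, ℝ) 𝓘(ℝ, E) φI s)

/-- The value at `x` of the function `m(dφS, dφS)`. -/
def minkowskiDifferentialSq (φS : MinkowskiSpace d → ℝ) (x : MinkowskiSpace d) : ℝ :=
  (minkowskiMetric d).dual x (fderiv ℝ φS x) (fderiv ℝ φS x)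

/-- `φ` is time-like: it factors with a time-like differential `dφS`. -/
def IsTimeLike (h : PseudoRiemannianMetric E N) (φ : MinkowskiSpace d → N) : Prop :=
  ∃ φS φI, IsTotallyGeodesicFactorization h φ φS φI ∧ ∀ x, minkowskiDifferentialSq φS x < 0

/-- `φ` is null: it factors with a null differential `dφS`. -/
def IsNull (h : PseudoRiemannianMetric E N) (φ : MinkowskiSpace d → N) : Prop :=
  ∃ φS φI, IsTotallyGeodesicFactorization h φ φS φI ∧ ∀ x, minkowskiDifferentialSq φS x = 0

/-- `φ` is space-like: it factors with a space-like differential `dφS`. -/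
def IsSpaceLike (h : PseudoRiemannianMetric E N) (φ : MinkowskiSpace d → N) : Prop :=
  ∃ φS φI, IsTotallyGeodesicFactorization h φ φS φI ∧ ∀ x, 0 < minkowskiDifferentialSq φS x

end Factorization

end

/-!
A totally geodesic map `φ` sends lines to geodesics, so in a chart of the target
`D²φ(v, v) + Γ(Dφ v, Dφ v) = 0`. Polarizing, `Dφ w = 0` implies `D²φ(v, w) = 0` for every `v`: the
kernel of `Dφ` is infinitesimally parallel. If moreover `Dφ` has rank one, then, for a linear form
`l` on the target and a vector `u` with `l (Dφ u) ≠ 0`, the linear form `l ∘ Dφ` has the same kernel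
as `Dφ`, and `(l (Dφ u))⁻¹ • (l ∘ Dφ)` has zero derivative. Hence `ker Dφ` is the same hyperplane at
every point, `φ` is constant along it, and `φ` factors through a linear form with that kernel, the
second factor being the restriction of `φ` to a transverse line.

The first factor of any factorization is a totally geodesic map between flat spaces, hence affine,
and its differential has kernel `ker Dφ`. So the differentials of the first factors of two
factorizations differ by a factor `c ≠ 0`, and their squared Minkowski norms by `c ^ 2 > 0`.
-/

open Filter Module Topology

section LinearAlgebra

lemma eq_div_smul_of_finrank_range_eq_one {K V W : Type*} [Field K] [AddCommGroup V] [Module K V]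
    [AddCommGroup W] [Module K W] {T : V →ₗ[K] W} (hT : finrank K T.range = 1) {l : W →ₗ[K] K}
    {u : V} (hu : l (T u) ≠ 0) (w : V) : T w = (l (T w) / l (T u)) • T u := by
  have hTu : (⟨T u, u, rfl⟩ : T.range) ≠ 0 := fun h0 ↦
    hu ((congrArg l (congrArg Subtype.val h0)).trans (map_zero l))
  obtain ⟨c, hc⟩ := (finrank_eq_one_iff_of_nonzero' _ hTu).1 hT ⟨T w, w, rfl⟩
  obtain hc : c • T u = T w := congrArg Subtype.val hc
  rw [← hc, map_smul, smul_eq_mul, mul_div_cancel_right₀ _ hu]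

lemma exists_apply_eq_one_of_finrank_range_eq_one {𝕜 V F : Type*} [Field 𝕜] [TopologicalSpace 𝕜]
    [IsTopologicalRing 𝕜] [AddCommGroup V] [Module 𝕜 V] [AddCommGroup F] [Module 𝕜 F]
    [TopologicalSpace F] [SeparatingDual 𝕜 F] {T : V →ₗ[𝕜] F} (hT : finrank 𝕜 T.range = 1) :
    ∃ (l : F →L[𝕜] 𝕜) (u : V), l (T u) = 1 := by
  obtain ⟨⟨_, u, rfl⟩, hne, -⟩ := finrank_eq_one_iff'.1 hT
  obtain ⟨l, hl⟩ := SeparatingDual.exists_eq_one (R := 𝕜) (x := T u) fun h0 ↦ hne (Subtype.ext h0)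
  exact ⟨l, u, hl⟩

lemma eq_smul_of_forall_apply_eq_zero {R V : Type*} [CommRing R] [AddCommGroup V] [Module R V]
    {α β : V →ₗ[R] R} (h : ∀ v, β v = 0 → α v = 0) {u : V} (hu : β u = 1) : α = α u • β := by
  ext v
  have hv : α (v - β v • u) = 0 := h _ (by simp [hu])
  rw [map_sub, map_smul, sub_eq_zero] at hv
  simp [hv, mul_comm]

lemma apply_eq_zero_of_apply_add_self_eq {K V F : Type*} [Field K] [NeZero (2 : K)]
    [AddCommGroup V] [Module K V] [AddCommGroup F] [Module K F] {B : V →ₗ[K] V →ₗ[K] F} {v w : V}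
    (hsymm : B w v = B v w) (hw : B w w = 0) (hvw : B (v + w) (v + w) = B v v) : B v w = 0 := by
  have h2 : (2 : K) • B v w = 0 := by
    simpa [hw, hsymm, two_smul, add_assoc] using hvw
  exact (smul_eq_zero.1 h2).resolve_left two_ne_zero

end LinearAlgebra

section Calculus

variable {𝕜 : Type*} [NontriviallyNormedField 𝕜] {V : Type*} [NormedAddCommGroup V]
  [NormedSpace 𝕜 V] {F : Type*} [NormedAddCommGroup F] [NormedSpace 𝕜 F] {f : V → F} {x v : V}

lemma deriv_comp_line {t : 𝕜} (hf : DifferentiableAt 𝕜 f (x + t • v)) :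
    deriv (fun s : 𝕜 ↦ f (x + s • v)) t = fderiv 𝕜 f (x + t • v) v := by
  have hline : HasDerivAt (fun s : 𝕜 ↦ x + s • v) v t := by
    simpa using ((hasDerivAt_id t).smul_const v).const_add x
  exact (hf.hasFDerivAt.comp_hasDerivAt t hline).deriv

lemma deriv_deriv_comp_line (hf : ContDiffAt 𝕜 2 f x) (v : V) :
    deriv (deriv fun t : 𝕜 ↦ f (x + t • v)) 0 = fderiv 𝕜 (fderiv 𝕜 f) x v v := by
  have hline : Tendsto (fun t : 𝕜 ↦ x + t • v) (𝓝 0) (𝓝 x) :=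
    Continuous.tendsto' (by fun_prop) _ _ (by simp)
  have hfst : deriv (fun t : 𝕜 ↦ f (x + t • v)) =ᶠ[𝓝 0] fun t ↦ fderiv 𝕜 f (x + t • v) v :=
    (hline.eventually (hf.eventually (by simp))).mono fun t ht ↦
      deriv_comp_line (ht.differentiableAt (by simp))
  have hsnd : DifferentiableAt 𝕜 (fderiv 𝕜 f) x :=
    (hf.fderiv_right (m := 1) (by norm_num)).differentiableAt (by simp)
  rw [hfst.deriv_eq, deriv_comp_line (f := fun y ↦ fderiv 𝕜 f y v)]
  · simp [fderiv_clm_apply hsnd (differentiableAt_const v)]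
  · simpa using hsnd.clm_apply (differentiableAt_const v)

lemma hasFDerivAt_inv_apply_smul_zero {α : V → V →L[𝕜] 𝕜} {u : V} (hα : DifferentiableAt 𝕜 α x)
    (hu : α x u ≠ 0) (hker : ∀ w, α x w = 0 → ∀ v, fderiv 𝕜 α x v w = 0) :
    HasFDerivAt (fun y ↦ (α y u)⁻¹ • α y) (0 : V →L[𝕜] V →L[𝕜] 𝕜) x := by
  have hαu : HasFDerivAt (fun y ↦ α y u) ((fderiv 𝕜 α x).flip u) x :=
    (hα.hasFDerivAt.clm_apply (hasFDerivAt_const u x)).congr_fderiv (by ext; simp)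
  have hproportional (v w : V) : α x u * fderiv 𝕜 α x v w = α x w * fderiv 𝕜 α x v u := by
    simpa [sub_eq_zero] using hker (α x u • w - α x w • u) (by simp [mul_comm]) v
  refine (((hasDerivAt_inv hu).comp_hasFDerivAt x hαu).fun_smul hα.hasFDerivAt).congr_fderiv ?_
  ext v w
  simp only [Function.comp_apply, add_apply, smul_apply, ContinuousLinearMap.smulRight_apply,
    ContinuousLinearMap.flip_apply, smul_eq_mul, neg_mul, neg_smul, neg_apply, zero_apply]
  field_simp
  linear_combination hproportional v w

end Calculus

section MeanValue

variable {𝕜 : Type*} [RCLike 𝕜] {V : Type*} [NormedAddCommGroup V] [NormedSpace 𝕜 V]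
  {F : Type*} [NormedAddCommGroup F] [NormedSpace 𝕜 F] {f : V → F} {x : V}

lemma eventually_eq_of_eventually_hasFDerivAt_zero
    (hf : ∀ᶠ y in 𝓝 x, HasFDerivAt f (0 : V →L[𝕜] F) y) : ∀ᶠ y in 𝓝 x, f y = f x := by
  let _ : NormedSpace ℝ V := .restrictScalars ℝ 𝕜 V
  obtain ⟨U, hU, hUo, hx⟩ := eventually_nhds_iff.1 hf
  have hopen : IsOpen (U ∩ f ⁻¹' {f x}) := hUo.isOpen_inter_preimage_of_fderiv_eq_zero
    (fun y hy ↦ (hU y hy).differentiableAt.differentiableWithinAt) (fun y hy ↦ (hU y hy).fderiv) _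
  exact (hopen.eventually_mem ⟨hx, rfl⟩).mono fun y hy ↦ hy.2

lemma exists_continuousAffineMap_of_fderiv_fderiv_eq_zero (hf : ContDiff 𝕜 2 f)
    (h : ∀ x, fderiv 𝕜 (fderiv 𝕜 f) x = 0) : ∃ a : V →ᴬ[𝕜] F, f = a := by
  have hfderiv : ∀ x, fderiv 𝕜 f x = fderiv 𝕜 f 0 := fun x ↦ is_const_of_fderiv_eq_zero
    ((hf.fderiv_right (m := 1) (by norm_num)).differentiable (by simp)) h x 0
  let a : V →ᴬ[𝕜] F := .const 𝕜 V (f 0) + (fderiv 𝕜 f 0).toContinuousAffineMap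
  refine ⟨a, eq_of_fderiv_eq (hf.differentiable (by simp)) a.differentiable (fun x ↦ ?_) 0 ?_⟩
  · rw [hfderiv x, ContinuousAffineMap.fderiv]
    ext v
    simp [a]
  · simp [a]

lemma eventually_fderiv_apply_eq_zero_iff (hf : ContDiffAt 𝕜 2 f x)
    (hrank : ∀ᶠ y in 𝓝 x, finrank 𝕜 (fderiv 𝕜 f y).range = 1)
    (hker : ∀ᶠ y in 𝓝 x, ∀ w, fderiv 𝕜 f y w = 0 → ∀ v, fderiv 𝕜 (fderiv 𝕜 f) y v w = 0) :
    ∀ᶠ y in 𝓝 x, ∀ w, fderiv 𝕜 f y w = 0 ↔ fderiv 𝕜 f x w = 0 := by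
  obtain ⟨l, u, hlu⟩ := exists_apply_eq_one_of_finrank_range_eq_one hrank.self_of_nhds
  replace hlu : l (fderiv 𝕜 f x u) ≠ 0 := ne_of_eq_of_ne hlu one_ne_zero
  let α (y : V) : V →L[𝕜] 𝕜 := l ∘L fderiv 𝕜 f y
  have hα : ∀ᶠ y in 𝓝 x, HasFDerivAt α
      ((ContinuousLinearMap.compL 𝕜 V F 𝕜 l) ∘L fderiv 𝕜 (fderiv 𝕜 f) y) y := by
    filter_upwards [hf.eventually (by simp)] with y hy
    exact (ContinuousLinearMap.compL 𝕜 V F 𝕜 l).hasFDerivAt.comp y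
      ((hy.fderiv_right (m := 1) (by norm_num)).differentiableAt (by simp)).hasFDerivAt
  have hu : ∀ᶠ y in 𝓝 x, α y u ≠ 0 :=
    (hα.self_of_nhds.continuousAt.clm_apply continuousAt_const).eventually_ne (by simp [α, hlu])
  have hα_iff : ∀ᶠ y in 𝓝 x, ∀ w, α y w = 0 ↔ fderiv 𝕜 f y w = 0 := by
    filter_upwards [hrank, hu] with y hy hyu w
    refine ⟨fun hw ↦ ?_, fun hw ↦ by simp [α, hw]⟩
    have := eq_div_smul_of_finrank_range_eq_one hy (l := l.toLinearMap) hyu w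
    simpa [show l (fderiv 𝕜 f y w) = 0 from hw] using this
  have hconst : ∀ᶠ y in 𝓝 x, (α y u)⁻¹ • α y = (α x u)⁻¹ • α x := by
    refine eventually_eq_of_eventually_hasFDerivAt_zero (𝕜 := 𝕜) (f := fun y ↦ (α y u)⁻¹ • α y) ?_
    filter_upwards [hα, hu, hα_iff, hker] with y hy hyu hy_iff hyker
    refine hasFDerivAt_inv_apply_smul_zero hy.differentiableAt hyu fun w hw v ↦ ?_
    simp [hy.fderiv, hyker w ((hy_iff w).1 hw) v]
  filter_upwards [hconst, hu, hα_iff] with y hy hyu hy_iff w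
  have hw := congrArg (· w = 0) hy
  simpa [hyu, hu.self_of_nhds, hy_iff, hα_iff.self_of_nhds] using hw

end MeanValue

namespace PseudoRiemannianMetric

section General

variable {E : Type*} [NormedAddCommGroup E] [NormedSpace ℝ E] {M : Type*} [TopologicalSpace M]
  [ChartedSpace E M] [IsManifold 𝓘(ℝ, E) ∞ M] {g : PseudoRiemannianMetric E M}

lemma christoffel_zero_zero (e : OpenPartialHomeomorph M E) (y : E) :
    g.christoffel e y 0 0 = 0 := by
  simp [christoffel]

lemma IsGeodesicOn.mono {γ : ℝ → M} {s t : Set ℝ} (hγ : g.IsGeodesicOn γ s) (hts : t ⊆ s) :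
    g.IsGeodesicOn γ t :=
  ⟨hγ.contMDiffOn.mono hts, fun r hr ↦ hγ.geodesic_eq r (hts hr)⟩

end General

section Flat

variable {V : Type*} [NormedAddCommGroup V] [NormedSpace ℝ V] {B : V →L[ℝ] V →L[ℝ] ℝ}
  {hsymm : ∀ v w, B v w = B w v} {hB : ∀ v, (∀ w, B v w = 0) → v = 0}

lemma inChart_const_refl (y : V) :
    (const B hsymm hB).inChart (OpenPartialHomeomorph.refl V) y = B := by
  have hid : mfderiv 𝓘(ℝ, V) 𝓘(ℝ, V) (OpenPartialHomeomorph.refl V).symm y = .id ℝ V :=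
    mfderiv_id
  simp only [inChart, hid]
  rfl

lemma christoffel_const_refl (y u v : V) :
    (const B hsymm hB).christoffel (OpenPartialHomeomorph.refl V) y u v = 0 := by
  simp [christoffel, funext (inChart_const_refl (hsymm := hsymm) (hB := hB))]

lemma isGeodesicOn_const_iff {γ : ℝ → V} {s : Set ℝ} :
    (const B hsymm hB).IsGeodesicOn γ s ↔
      ContDiffOn ℝ ∞ γ s ∧ ∀ t ∈ s, deriv (deriv γ) t = 0 := by
  refine ⟨fun hγ ↦ ⟨hγ.contMDiffOn.contDiffOn, fun t ht ↦ ?_⟩, fun hγ ↦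
    ⟨hγ.1.contMDiffOn, fun t ht e he _ ↦ ?_⟩⟩
  · simpa [christoffel_const_refl, Function.comp_def] using
      hγ.geodesic_eq t ht (OpenPartialHomeomorph.refl V) (by simp) (by simp)
  · obtain rfl := chartedSpaceSelf_atlas.1 he
    simpa [christoffel_const_refl, Function.comp_def] using hγ.2 t ht

lemma isGeodesicOn_const_line (x v : V) :
    (const B hsymm hB).IsGeodesicOn (fun t ↦ x + t • v) univ := by
  have hderiv : deriv (fun t : ℝ ↦ x + t • v) = fun _ ↦ v := by
    funext t
    simpa using (((hasDerivAt_id t).smul_const v).const_add x).deriv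
  exact isGeodesicOn_const_iff.2 ⟨ContDiff.contDiffOn (by fun_prop), by simp [hderiv]⟩

lemma IsGeodesicOn.continuousAffineMap_comp {F : Type*} [NormedAddCommGroup F] [NormedSpace ℝ F]
    {B' : F →L[ℝ] F →L[ℝ] ℝ} {hsymm' : ∀ v w, B' v w = B' w v}
    {hB' : ∀ v, (∀ w, B' v w = 0) → v = 0} {γ : ℝ → V} {s : Set ℝ}
    (hγ : (const B hsymm hB).IsGeodesicOn γ s) (hs : IsOpen s) (a : V →ᴬ[ℝ] F) :
    (const B' hsymm' hB').IsGeodesicOn (a ∘ γ) s := by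
  obtain ⟨hsmooth, hγ₂⟩ := isGeodesicOn_const_iff.1 hγ
  refine isGeodesicOn_const_iff.2 ⟨a.contDiff.comp_contDiffOn hsmooth, fun t ht ↦ ?_⟩
  have hfst : deriv (a ∘ γ) =ᶠ[𝓝 t] a.contLinear ∘ deriv γ := by
    filter_upwards [hs.mem_nhds ht] with r hr
    rw [fderiv_comp_deriv r a.differentiable.differentiableAt
      ((hsmooth.contDiffAt (hs.mem_nhds hr)).differentiableAt (by simp)),
      ContinuousAffineMap.fderiv, Function.comp_apply]
  have hdiff : DifferentiableAt ℝ (deriv γ) t :=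
    ((hsmooth.deriv_of_isOpen (m := 1) hs (by norm_cast)).contDiffAt
      (hs.mem_nhds ht)).differentiableAt (by simp)
  rw [hfst.deriv_eq, (a.contLinear.hasFDerivAt.comp_hasDerivAt t hdiff.hasDerivAt).deriv,
    hγ₂ t ht, map_zero]

end Flat

end PseudoRiemannianMetric

section Chart

variable {𝕜 : Type*} [NontriviallyNormedField 𝕜] {V : Type*} [NormedAddCommGroup V]
  [NormedSpace 𝕜 V] {E : Type*} [NormedAddCommGroup E] [NormedSpace 𝕜 E] {N : Type*}
  [TopologicalSpace N] [ChartedSpace E N] {e : OpenPartialHomeomorph N E} {φ : V → N} {x : V}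

lemma contDiffAt_chart_comp {n : ℕ∞ω} [IsManifold 𝓘(𝕜, E) n N] (he : e ∈ atlas E N)
    (hφ : ContMDiffAt 𝓘(𝕜, V) 𝓘(𝕜, E) n φ x) (hx : φ x ∈ e.source) :
    ContDiffAt 𝕜 n (e ∘ φ) x :=
  ((contMDiffAt_of_mem_maximalAtlas (I := 𝓘(𝕜, E)) (IsManifold.subset_maximalAtlas he) hx).comp x
    hφ).contDiffAt

variable [IsManifold 𝓘(𝕜, E) 1 N]

lemma fderiv_chart_comp_apply (he : e ∈ atlas E N) (hφ : MDifferentiableAt 𝓘(𝕜, V) 𝓘(𝕜, E) φ x)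
    (hx : φ x ∈ e.source) (w : V) :
    fderiv 𝕜 (e ∘ φ) x w = mfderiv 𝓘(𝕜, E) 𝓘(𝕜, E) e (φ x) (mfderiv 𝓘(𝕜, V) 𝓘(𝕜, E) φ x w) := by
  rw [← mfderiv_eq_fderiv,
    mfderiv_comp x ((mdifferentiable_of_mem_atlas he).mdifferentiableAt hx) hφ]
  rfl

lemma fderiv_chart_comp_apply_eq_zero_iff (he : e ∈ atlas E N)
    (hφ : MDifferentiableAt 𝓘(𝕜, V) 𝓘(𝕜, E) φ x) (hx : φ x ∈ e.source) {w : V} :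
    fderiv 𝕜 (e ∘ φ) x w = 0 ↔ mfderiv 𝓘(𝕜, V) 𝓘(𝕜, E) φ x w = 0 := by
  rw [fderiv_chart_comp_apply he hφ hx]
  exact map_eq_zero_iff _ ((mdifferentiable_of_mem_atlas he).mfderiv_injective hx)

lemma finrank_range_fderiv_chart_comp (he : e ∈ atlas E N)
    (hφ : MDifferentiableAt 𝓘(𝕜, V) 𝓘(𝕜, E) φ x) (hx : φ x ∈ e.source) :
    finrank 𝕜 (fderiv 𝕜 (e ∘ φ) x).range = finrank 𝕜 (mfderiv 𝓘(𝕜, V) 𝓘(𝕜, E) φ x).range := by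
  let A : E →ₗ[𝕜] E := (mfderiv 𝓘(𝕜, E) 𝓘(𝕜, E) e (φ x)).toLinearMap
  let T : V →ₗ[𝕜] E := (mfderiv 𝓘(𝕜, V) 𝓘(𝕜, E) φ x).toLinearMap
  have hcomp : (fderiv 𝕜 (e ∘ φ) x).toLinearMap = A ∘ₗ T :=
    LinearMap.ext (fderiv_chart_comp_apply he hφ hx)
  have hA : Function.Injective A := (mdifferentiable_of_mem_atlas he).mfderiv_injective hx
  rw [hcomp, LinearMap.range_comp]
  exact (Submodule.equivMapOfInjective A hA T.range).symm.finrank_eq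

end Chart

lemma isLocallyConstant_of_mfderiv_eq_zero {𝕜 : Type*} [RCLike 𝕜] {V : Type*}
    [NormedAddCommGroup V] [NormedSpace 𝕜 V] {E : Type*} [NormedAddCommGroup E] [NormedSpace 𝕜 E]
    {N : Type*} [TopologicalSpace N] [ChartedSpace E N] [IsManifold 𝓘(𝕜, E) 1 N] {f : V → N}
    (hf : MDifferentiable 𝓘(𝕜, V) 𝓘(𝕜, E) f) (h : ∀ x, mfderiv 𝓘(𝕜, V) 𝓘(𝕜, E) f x = 0) :
    IsLocallyConstant f := by
  refine (IsLocallyConstant.iff_eventually_eq f).2 fun x ↦ ?_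
  let e := chartAt E (f x)
  have he : e ∈ atlas E N := chart_mem_atlas E (f x)
  have hsource : ∀ᶠ y in 𝓝 x, f y ∈ e.source :=
    (hf x).continuousAt.eventually_mem (e.open_source.mem_nhds (mem_chart_source E (f x)))
  have hchart : ∀ᶠ y in 𝓝 x, HasFDerivAt (e ∘ f) (0 : V →L[𝕜] E) y := by
    filter_upwards [hsource] with y hy
    have hdiff : DifferentiableAt 𝕜 (e ∘ f) y :=
      (((mdifferentiable_of_mem_atlas he).mdifferentiableAt hy).comp y (hf y)).differentiableAt
    refine hdiff.hasFDerivAt.congr_fderiv (ContinuousLinearMap.ext fun w ↦ ?_)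
    exact (fderiv_chart_comp_apply_eq_zero_iff he (hf y) hy).2 (congrArg (· w) (h y))
  filter_upwards [hsource, eventually_eq_of_eventually_hasFDerivAt_zero hchart] with y hy hey
  exact e.injOn hy (mem_chart_source E (f x)) hey

lemma apply_add_eq_of_forall_mfderiv_apply_eq_zero {𝕜 : Type*} [RCLike 𝕜] {V : Type*}
    [NormedAddCommGroup V] [NormedSpace 𝕜 V] {E : Type*} [NormedAddCommGroup E] [NormedSpace 𝕜 E]
    {N : Type*} [TopologicalSpace N] [ChartedSpace E N] [IsManifold 𝓘(𝕜, E) 1 N] {f : V → N}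
    (hf : MDifferentiable 𝓘(𝕜, V) 𝓘(𝕜, E) f) {w : V}
    (hw : ∀ x, mfderiv 𝓘(𝕜, V) 𝓘(𝕜, E) f x w = 0) (x : V) : f (x + w) = f x := by
  let line (t : 𝕜) : V := x + t • w
  have hline (t : 𝕜) : HasFDerivAt line (.toSpanSingleton 𝕜 w) t :=
    (ContinuousLinearMap.toSpanSingleton 𝕜 w).hasFDerivAt.const_add x
  have hdiff : MDifferentiable 𝓘(𝕜, 𝕜) 𝓘(𝕜, V) line :=
    fun t ↦ (hline t).differentiableAt.mdifferentiableAt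
  have hconst : IsLocallyConstant (f ∘ line) := by
    refine isLocallyConstant_of_mfderiv_eq_zero (hf.comp hdiff) fun t ↦ ?_
    refine ContinuousLinearMap.ext fun (c : 𝕜) ↦ ?_
    rw [mfderiv_comp t (hf _) (hdiff t), mfderiv_eq_fderiv, (hline t).fderiv]
    exact (map_smul (mfderiv 𝓘(𝕜, V) 𝓘(𝕜, E) f (line t)) c w).trans
      (smul_eq_zero_of_right c (hw (line t)))
  simpa [line] using hconst.apply_eq_of_preconnectedSpace 1 0

namespace IsTotallyGeodesic

section General

variable {E₁ : Type*} [NormedAddCommGroup E₁] [NormedSpace ℝ E₁] {M₁ : Type*} [TopologicalSpace M₁]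
  [ChartedSpace E₁ M₁] [IsManifold 𝓘(ℝ, E₁) ∞ M₁] {g₁ : PseudoRiemannianMetric E₁ M₁}
  {E₂ : Type*} [NormedAddCommGroup E₂] [NormedSpace ℝ E₂] {M₂ : Type*} [TopologicalSpace M₂]
  [ChartedSpace E₂ M₂] [IsManifold 𝓘(ℝ, E₂) ∞ M₂] {g₂ : PseudoRiemannianMetric E₂ M₂}
  {E₃ : Type*} [NormedAddCommGroup E₃] [NormedSpace ℝ E₃] {M₃ : Type*} [TopologicalSpace M₃]
  [ChartedSpace E₃ M₃] [IsManifold 𝓘(ℝ, E₃) ∞ M₃] {g₃ : PseudoRiemannianMetric E₃ M₃}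
  {f : M₁ → M₂}

lemma comp {f' : M₂ → M₃} (hf' : IsTotallyGeodesic g₂ g₃ f') (hf : IsTotallyGeodesic g₁ g₂ f) :
    IsTotallyGeodesic g₁ g₃ (f' ∘ f) :=
  ⟨hf'.contMDiff.comp hf.contMDiff,
    fun γ a b hγ ↦ hf'.map_geodesic (f ∘ γ) a b (hf.map_geodesic γ a b hγ)⟩

lemma isGeodesicOn_comp (hf : IsTotallyGeodesic g₁ g₂ f) {γ : ℝ → M₁} {s : Set ℝ} (hs : IsOpen s)
    (hγ : g₁.IsGeodesicOn γ s) : g₂.IsGeodesicOn (f ∘ γ) s := by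
  refine ⟨hf.contMDiff.comp_contMDiffOn hγ.contMDiffOn, fun t ht ↦ ?_⟩
  obtain ⟨a, b, htab, hab⟩ := mem_nhds_iff_exists_Ioo_subset.1 (hs.mem_nhds ht)
  exact (hf.map_geodesic γ a b (hγ.mono hab)).geodesic_eq t htab

end General

section FlatSource

variable {V : Type*} [NormedAddCommGroup V] [NormedSpace ℝ V] {B : V →L[ℝ] V →L[ℝ] ℝ}
  {hsymm : ∀ v w, B v w = B w v} {hB : ∀ v, (∀ w, B v w = 0) → v = 0}
  {E : Type*} [NormedAddCommGroup E] [NormedSpace ℝ E] {N : Type*} [TopologicalSpace N]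
  [ChartedSpace E N] [IsManifold 𝓘(ℝ, E) ∞ N] {h : PseudoRiemannianMetric E N} {φ : V → N}
  {e : OpenPartialHomeomorph N E} {x : V}

lemma isGeodesicOn_line (hφ : IsTotallyGeodesic (.const B hsymm hB) h φ) (x v : V) :
    h.IsGeodesicOn (fun t ↦ φ (x + t • v)) univ :=
  hφ.isGeodesicOn_comp isOpen_univ (PseudoRiemannianMetric.isGeodesicOn_const_line x v)

lemma fderiv_fderiv_chart_comp_add_christoffel (hφ : IsTotallyGeodesic (.const B hsymm hB) h φ)
    (he : e ∈ atlas E N) (hx : φ x ∈ e.source) (v : V) :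
    fderiv ℝ (fderiv ℝ (e ∘ φ)) x v v
      + h.christoffel e (e (φ x)) (fderiv ℝ (e ∘ φ) x v) (fderiv ℝ (e ∘ φ) x v) = 0 := by
  have hsmooth : ContDiffAt ℝ ∞ (e ∘ φ) x := contDiffAt_chart_comp he hφ.contMDiff.contMDiffAt hx
  have hfst : deriv (fun t : ℝ ↦ (e ∘ φ) (x + t • v)) 0 = fderiv ℝ (e ∘ φ) x v := by
    have hdiff : DifferentiableAt ℝ (e ∘ φ) (x + (0 : ℝ) • v) := by
      simpa using hsmooth.differentiableAt (by simp)
    simpa only [zero_smul, add_zero] using deriv_comp_line hdiff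
  have hsnd := deriv_deriv_comp_line (hsmooth.of_le ENat.LEInfty.out) v
  rw [← hfst, ← hsnd]
  simpa [Function.comp_def] using
    (hφ.isGeodesicOn_line x v).geodesic_eq 0 (mem_univ 0) e he (by simpa using hx)

lemma fderiv_fderiv_chart_comp_apply_eq_zero (hφ : IsTotallyGeodesic (.const B hsymm hB) h φ)
    (he : e ∈ atlas E N) (hx : φ x ∈ e.source) {w : V} (hw : fderiv ℝ (e ∘ φ) x w = 0) (v : V) :
    fderiv ℝ (fderiv ℝ (e ∘ φ)) x v w = 0 := by
  have hsymmSnd : IsSymmSndFDerivAt ℝ (e ∘ φ) x :=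
    (contDiffAt_chart_comp he hφ.contMDiff.contMDiffAt hx).isSymmSndFDerivAt
      (by simpa using ENat.LEInfty.out)
  have hdiag := hφ.fderiv_fderiv_chart_comp_add_christoffel he hx
  have hww := hdiag w
  have hvw := (hdiag (v + w)).trans (hdiag v).symm
  rw [hw, PseudoRiemannianMetric.christoffel_zero_zero, add_zero] at hww
  rw [map_add (fderiv ℝ (e ∘ φ) x), hw, add_zero] at hvw
  exact apply_eq_zero_of_apply_add_self_eq
    (B := (fderiv ℝ (fderiv ℝ (e ∘ φ)) x).toLinearMap₁₂) (hsymmSnd.eq w v) hww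
    (add_right_cancel hvw)

lemma mfderiv_apply_eq_zero_iff (hφ : IsTotallyGeodesic (.const B hsymm hB) h φ)
    (hrank : ∀ x, finrank ℝ (mfderiv 𝓘(ℝ, V) 𝓘(ℝ, E) φ x).range = 1) {x y w : V} :
    mfderiv 𝓘(ℝ, V) 𝓘(ℝ, E) φ x w = 0 ↔ mfderiv 𝓘(ℝ, V) 𝓘(ℝ, E) φ y w = 0 := by
  let ker (x : V) : Set V := {w | mfderiv 𝓘(ℝ, V) 𝓘(ℝ, E) φ x w = 0}
  suffices hconst : IsLocallyConstant ker from
    Set.ext_iff.1 (hconst.apply_eq_of_preconnectedSpace x y) w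
  have hdiff : MDifferentiable 𝓘(ℝ, V) 𝓘(ℝ, E) φ := hφ.contMDiff.mdifferentiable (by simp)
  refine (IsLocallyConstant.iff_eventually_eq ker).2 fun x ↦ ?_
  let e := chartAt E (φ x)
  have he : e ∈ atlas E N := chart_mem_atlas E (φ x)
  have hx : φ x ∈ e.source := mem_chart_source E (φ x)
  have hsource : ∀ᶠ y in 𝓝 x, φ y ∈ e.source :=
    hφ.contMDiff.continuous.continuousAt.eventually_mem (e.open_source.mem_nhds hx)
  have hker : ∀ᶠ y in 𝓝 x, ∀ w, fderiv ℝ (e ∘ φ) y w = 0 ↔ fderiv ℝ (e ∘ φ) x w = 0 :=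
    eventually_fderiv_apply_eq_zero_iff
      ((contDiffAt_chart_comp he hφ.contMDiff.contMDiffAt hx).of_le ENat.LEInfty.out)
      (hsource.mono fun y hy ↦ (finrank_range_fderiv_chart_comp he (hdiff y) hy).trans (hrank y))
      (hsource.mono fun y hy w ↦ hφ.fderiv_fderiv_chart_comp_apply_eq_zero he hy)
  filter_upwards [hsource, hker] with y hy hyker
  ext w
  exact (fderiv_chart_comp_apply_eq_zero_iff he (hdiff y) hy).symm.trans
    ((hyker w).trans (fderiv_chart_comp_apply_eq_zero_iff he (hdiff x) hx))

lemma exists_linearForm_of_finrank_range_eq_one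
    (hφ : IsTotallyGeodesic (.const B hsymm hB) h φ)
    (hrank : ∀ x, finrank ℝ (mfderiv 𝓘(ℝ, V) 𝓘(ℝ, E) φ x).range = 1) :
    ∃ (l : V →L[ℝ] ℝ) (u : V), l u = 1 ∧ (∀ x, φ x = φ (l x • u)) ∧
      ∀ x w, mfderiv 𝓘(ℝ, V) 𝓘(ℝ, E) φ x w = 0 ↔ l w = 0 := by
  let T : V →L[ℝ] E := mfderiv 𝓘(ℝ, V) 𝓘(ℝ, E) φ 0
  have hT : finrank ℝ T.range = 1 := hrank 0
  obtain ⟨l', u, hu⟩ := exists_apply_eq_one_of_finrank_range_eq_one hT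
  let l : V →L[ℝ] ℝ := l' ∘L T
  have hker (w : V) : T w = 0 ↔ l w = 0 := by
    refine ⟨fun hw ↦ (congrArg l' hw).trans (map_zero l'), fun hw ↦ ?_⟩
    have hTw := eq_div_smul_of_finrank_range_eq_one hT (l := l'.toLinearMap)
      (ne_of_eq_of_ne hu one_ne_zero) w
    exact hTw.trans (smul_eq_zero_of_left (div_eq_zero_iff.2 (.inl hw)) _)
  have hmfderiv (x w : V) : mfderiv 𝓘(ℝ, V) 𝓘(ℝ, E) φ x w = 0 ↔ l w = 0 :=
    (hφ.mfderiv_apply_eq_zero_iff hrank).trans (hker w)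
  refine ⟨l, u, hu, fun x ↦ ?_, hmfderiv⟩
  have hlu : l u = 1 := hu
  have hdiff : l (x - l x • u) = 0 := by simp [hlu]
  simpa using apply_add_eq_of_forall_mfderiv_apply_eq_zero
    (hφ.contMDiff.mdifferentiable (by simp)) (fun y ↦ (hmfderiv y _).2 hdiff) (l x • u)

end FlatSource

end IsTotallyGeodesic

lemma isTotallyGeodesic_const_iff {V : Type*} [NormedAddCommGroup V] [NormedSpace ℝ V]
    {B : V →L[ℝ] V →L[ℝ] ℝ} {hsymm : ∀ v w, B v w = B w v} {hB : ∀ v, (∀ w, B v w = 0) → v = 0}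
    {F : Type*} [NormedAddCommGroup F] [NormedSpace ℝ F] {B' : F →L[ℝ] F →L[ℝ] ℝ}
    {hsymm' : ∀ v w, B' v w = B' w v} {hB' : ∀ v, (∀ w, B' v w = 0) → v = 0} {f : V → F} :
    IsTotallyGeodesic (.const B hsymm hB) (.const B' hsymm' hB') f ↔
      ∃ a : V →ᴬ[ℝ] F, f = a := by
  refine ⟨fun hf ↦ ?_, ?_⟩
  · have hsmooth : ContDiff ℝ ∞ f := hf.contMDiff.contDiff
    have hdiag (x v : V) : fderiv ℝ (fderiv ℝ f) x v v = 0 := by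
      simpa [PseudoRiemannianMetric.christoffel_const_refl, Function.comp_def] using
        hf.fderiv_fderiv_chart_comp_add_christoffel (e := .refl F) (x := x) (by simp) (by simp) v
    refine exists_continuousAffineMap_of_fderiv_fderiv_eq_zero (hsmooth.of_le ENat.LEInfty.out)
      fun x ↦ ?_
    ext v w
    have hsymmSnd : IsSymmSndFDerivAt ℝ f x :=
      hsmooth.contDiffAt.isSymmSndFDerivAt (by simpa using ENat.LEInfty.out)
    exact apply_eq_zero_of_apply_add_self_eq (B := (fderiv ℝ (fderiv ℝ f) x).toLinearMap₁₂)
      (hsymmSnd.eq w v) (hdiag x w) ((hdiag x (v + w)).trans (hdiag x v).symm)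
  · rintro ⟨a, rfl⟩
    exact ⟨a.contDiff.contMDiff, fun γ s t hγ ↦ hγ.continuousAffineMap_comp isOpen_Ioo a⟩

section Factorization

variable {E : Type*} [NormedAddCommGroup E] [NormedSpace ℝ E] {N : Type*} [TopologicalSpace N]
  [ChartedSpace E N] [IsManifold 𝓘(ℝ, E) ∞ N] {d : ℕ} {h : PseudoRiemannianMetric E N}
  {φ : MinkowskiSpace d → N} {φS φS' : MinkowskiSpace d → ℝ} {φI φI' : ℝ → N}

lemma exists_isTotallyGeodesicFactorization (hφ : IsTotallyGeodesic (minkowskiMetric d) h φ)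
    (hrank : ∀ x, finrank ℝ (mfderiv 𝓘(ℝ, MinkowskiSpace d) 𝓘(ℝ, E) φ x).range = 1) :
    ∃ φS φI, IsTotallyGeodesicFactorization h φ φS φI := by
  obtain ⟨l, u, hu, hφl, hker⟩ := hφ.exists_linearForm_of_finrank_range_eq_one hrank
  let L : ℝ →L[ℝ] MinkowskiSpace d := .toSpanSingleton ℝ u
  refine ⟨l, φ ∘ L, funext hφl, isTotallyGeodesic_const_iff.2 ⟨l.toContinuousAffineMap, rfl⟩, ?_,
    hφ.comp (isTotallyGeodesic_const_iff.2 ⟨L.toContinuousAffineMap, rfl⟩), ?_⟩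
  · intro x
    rw [mfderiv_eq_fderiv, l.fderiv]
    have hsurj : Function.Surjective l := fun c ↦ ⟨c • u, by simp [hu]⟩
    exact hsurj
  · intro s
    rw [mfderiv_comp s (hφ.contMDiff.mdifferentiable (by simp) _)
      L.differentiableAt.mdifferentiableAt, mfderiv_eq_fderiv, L.fderiv]
    refine (injective_iff_map_eq_zero _).2 fun (c : ℝ) hc ↦ ?_
    have hc' : l (c • u) = 0 := (hker (L s) (L c)).1 hc
    rwa [map_smul, hu, smul_eq_mul, mul_one] at hc'

lemma minkowskiDifferentialSq_eq_apply_inverse (φS : MinkowskiSpace d → ℝ) (x : MinkowskiSpace d) :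
    minkowskiDifferentialSq φS x = fderiv ℝ φS x ((minkowskiForm d).inverse (fderiv ℝ φS x)) :=
  rfl

namespace IsTotallyGeodesicFactorization

lemma exists_continuousAffineMap (hf : IsTotallyGeodesicFactorization h φ φS φI) :
    ∃ a : MinkowskiSpace d →ᴬ[ℝ] ℝ, φS = a :=
  isTotallyGeodesic_const_iff.1 hf.totallyGeodesic_fst

lemma isGeodesicOn_univ (hf : IsTotallyGeodesicFactorization h φ φS φI) :
    h.IsGeodesicOn φI univ := by
  simpa using hf.totallyGeodesic_snd.isGeodesicOn_line 0 1

lemma minkowskiDifferentialSq_eq (hf : IsTotallyGeodesicFactorization h φ φS φI)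
    (x y : MinkowskiSpace d) : minkowskiDifferentialSq φS x = minkowskiDifferentialSq φS y := by
  obtain ⟨a, rfl⟩ := hf.exists_continuousAffineMap
  simp only [minkowskiDifferentialSq_eq_apply_inverse, ContinuousAffineMap.fderiv]

lemma mfderiv_apply_eq_zero_iff (hf : IsTotallyGeodesicFactorization h φ φS φI)
    {x v : MinkowskiSpace d} :
    mfderiv 𝓘(ℝ, MinkowskiSpace d) 𝓘(ℝ, E) φ x v = 0 ↔ fderiv ℝ φS x v = 0 := by
  rw [hf.eq_comp, mfderiv_comp x (hf.totallyGeodesic_snd.contMDiff.mdifferentiable (by simp) _)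
    (hf.totallyGeodesic_fst.contMDiff.mdifferentiable (by simp) _), mfderiv_eq_fderiv]
  exact map_eq_zero_iff (mfderiv 𝓘(ℝ, ℝ) 𝓘(ℝ, E) φI (φS x)) (hf.immersion _)

lemma exists_fderiv_eq_smul (hf : IsTotallyGeodesicFactorization h φ φS φI)
    (hf' : IsTotallyGeodesicFactorization h φ φS' φI') (x : MinkowskiSpace d) :
    ∃ c : ℝ, c ≠ 0 ∧ fderiv ℝ φS' x = c • fderiv ℝ φS x := by
  have hker (v : MinkowskiSpace d) : fderiv ℝ φS x v = 0 ↔ fderiv ℝ φS' x v = 0 :=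
    hf.mfderiv_apply_eq_zero_iff.symm.trans hf'.mfderiv_apply_eq_zero_iff
  obtain ⟨u, hu⟩ : ∃ u, fderiv ℝ φS x u = 1 := by
    rw [← mfderiv_eq_fderiv]
    exact hf.submersion x (1 : ℝ)
  refine ⟨fderiv ℝ φS' x u, fun hu' ↦ one_ne_zero (hu.symm.trans ((hker u).2 hu')), ?_⟩
  exact ContinuousLinearMap.coe_injective
    (eq_smul_of_forall_apply_eq_zero (fun v ↦ (hker v).1) hu)

lemma exists_minkowskiDifferentialSq_eq_mul (hf : IsTotallyGeodesicFactorization h φ φS φI)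
    (hf' : IsTotallyGeodesicFactorization h φ φS' φI') (x : MinkowskiSpace d) :
    ∃ c : ℝ, 0 < c ∧ minkowskiDifferentialSq φS' x = c * minkowskiDifferentialSq φS x := by
  obtain ⟨c, hc, hsmul⟩ := hf.exists_fderiv_eq_smul hf' x
  refine ⟨c ^ 2, by positivity, ?_⟩
  simp only [minkowskiDifferentialSq_eq_apply_inverse, hsmul, map_smul, smul_apply, smul_eq_mul]
  ring

lemma isTimeLike_iff (hf : IsTotallyGeodesicFactorization h φ φS φI) :
    IsTimeLike h φ ↔ minkowskiDifferentialSq φS 0 < 0 := by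
  refine ⟨fun ⟨_, _, hf', hneg⟩ ↦ ?_, fun hneg ↦ ⟨φS, φI, hf, fun x ↦ ?_⟩⟩
  · obtain ⟨c, hc, hmul⟩ := hf'.exists_minkowskiDifferentialSq_eq_mul hf 0
    exact hmul ▸ mul_neg_of_pos_of_neg hc (hneg 0)
  · rwa [hf.minkowskiDifferentialSq_eq x 0]

lemma isNull_iff (hf : IsTotallyGeodesicFactorization h φ φS φI) :
    IsNull h φ ↔ minkowskiDifferentialSq φS 0 = 0 := by
  refine ⟨fun ⟨_, _, hf', hzero⟩ ↦ ?_, fun hzero ↦ ⟨φS, φI, hf, fun x ↦ ?_⟩⟩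
  · obtain ⟨c, -, hmul⟩ := hf'.exists_minkowskiDifferentialSq_eq_mul hf 0
    exact hmul ▸ mul_eq_zero_of_right c (hzero 0)
  · rwa [hf.minkowskiDifferentialSq_eq x 0]

lemma isSpaceLike_iff (hf : IsTotallyGeodesicFactorization h φ φS φI) :
    IsSpaceLike h φ ↔ 0 < minkowskiDifferentialSq φS 0 := by
  refine ⟨fun ⟨_, _, hf', hpos⟩ ↦ ?_, fun hpos ↦ ⟨φS, φI, hf, fun x ↦ ?_⟩⟩
  · obtain ⟨c, hc, hmul⟩ := hf'.exists_minkowskiDifferentialSq_eq_mul hf 0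
    exact hmul ▸ mul_pos hc (hpos 0)
  · rwa [hf.minkowskiDifferentialSq_eq x 0]

end IsTotallyGeodesicFactorization

end Factorization

theorem mainTheorem3_general (d : ℕ)
    {E : Type*} [NormedAddCommGroup E] [NormedSpace ℝ E]
    {N : Type*} [TopologicalSpace N] [ChartedSpace E N] [IsManifold 𝓘(ℝ, E) ∞ N]
    (h : PseudoRiemannianMetric E N) (φ : MinkowskiSpace d → N)
    (hφ : IsTotallyGeodesic (minkowskiMetric d) h φ)
    (hrank : ∀ x, Module.finrank ℝ
      (mfderiv 𝓘(ℝ, MinkowskiSpace d) 𝓘(ℝ, E) φ x).range = 1) :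
    (∃ φS φI, IsTotallyGeodesicFactorization h φ φS φI) ∧
    (∀ φS φI, IsTotallyGeodesicFactorization h φ φS φI →
      (∃ a : MinkowskiSpace d →ᴬ[ℝ] ℝ, φS = a) ∧
      h.IsGeodesicOn φI univ ∧
      ∃ c : ℝ, ∀ x, minkowskiDifferentialSq φS x = c) ∧
    ((IsTimeLike h φ ∧ ¬ IsNull h φ ∧ ¬ IsSpaceLike h φ) ∨
      (¬ IsTimeLike h φ ∧ IsNull h φ ∧ ¬ IsSpaceLike h φ) ∨
      (¬ IsTimeLike h φ ∧ ¬ IsNull h φ ∧ IsSpaceLike h φ)) := by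
  obtain ⟨φS, φI, hf⟩ := exists_isTotallyGeodesicFactorization hφ hrank
  refine ⟨⟨φS, φI, hf⟩, fun ψS ψI hψ ↦ ⟨hψ.exists_continuousAffineMap, hψ.isGeodesicOn_univ,
    _, fun x ↦ hψ.minkowskiDifferentialSq_eq x 0⟩, ?_⟩
  rw [hf.isTimeLike_iff, hf.isNull_iff, hf.isSpaceLike_iff]
  rcases lt_trichotomy (minkowskiDifferentialSq φS 0) 0 with hneg | hzero | hpos
  · exact .inl ⟨hneg, hneg.ne, hneg.not_gt⟩
  · exact .inr (.inl ⟨hzero.not_lt, hzero, hzero.not_gt⟩)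
  · exact .inr (.inr ⟨hpos.not_gt, hpos.ne', hpos⟩)

theorem mainTheorem3 (d : ℕ)
    {E : Type*} [NormedAddCommGroup E] [NormedSpace ℝ E] [FiniteDimensional ℝ E]
    {N : Type*} [TopologicalSpace N] [ChartedSpace E N] [IsManifold 𝓘(ℝ, E) ∞ N]
    (h : Bundle.ContMDiffRiemannianMetric 𝓘(ℝ, E) ∞ E (fun x : N ↦ TangentSpace 𝓘(ℝ, E) x))
    (φ : MinkowskiSpace d → N)
    (hφ : IsTotallyGeodesic (minkowskiMetric d) h.toPseudo φ)
    (hrank : ∀ x, Module.finrank ℝ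
      (mfderiv 𝓘(ℝ, MinkowskiSpace d) 𝓘(ℝ, E) φ x).range = 1) :
    (∃ φS φI, IsTotallyGeodesicFactorization h.toPseudo φ φS φI) ∧
    (∀ φS φI, IsTotallyGeodesicFactorization h.toPseudo φ φS φI →
      (∃ a : MinkowskiSpace d →ᴬ[ℝ] ℝ, φS = a) ∧
      h.toPseudo.IsGeodesicOn φI univ ∧
      ∃ c : ℝ, ∀ x, minkowskiDifferentialSq φS x = c) ∧
    ((IsTimeLike h.toPseudo φ ∧ ¬ IsNull h.toPseudo φ ∧ ¬ IsSpaceLike h.toPseudo φ) ∨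
      (¬ IsTimeLike h.toPseudo φ ∧ IsNull h.toPseudo φ ∧ ¬ IsSpaceLike h.toPseudo φ) ∨
      (¬ IsTimeLike h.toPseudo φ ∧ ¬ IsNull h.toPseudo φ ∧ IsSpaceLike h.toPseudo φ)) :=
  mainTheorem3_general d h.toPseudo φ hφ hrank
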